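/- Fix an algebraic language (constant symbols are allowed). A variety is the class of all algebras satisfying a given set of identities. An identity is regular if the same variables occur on both of its sides. For a variety $V$, its regularization $R(V)$ is the variety defined by the regular identities valid in $V$. $V$ is strongly irregular if there is a term $t(x,y)$, in which both variables $x$ and $y$ actually occur, such that $V\models t(x,y)\approx x$. Algebras may have empty universe (possible only if the language has no constants). An algebra $A$ is free in a variety $W$ on a family $(a_x)_{x\in X}$ of its elements if $A\in W$, $A$ is generated by $\{a_x\}_{x\in X}$, and for every $B\in W$ every map $X\to B$, $x\mapsto b_x$, is induced by a homomorphism $h\colon A\to B$ with $h(a_x)=b_x$ for all $x\in X$. A semilattice direct system consists of a join semilattice $(I,\le)$ with least element $i_0$, algebras $A_i$ ($i\in I$) and homomorphisms $p_{ik}\colon A_i\to A_k$ ($i\le k$) with $p_{ii}=\mathrm{id}$ and $p_{il}=p_{kl}\circ p_{ik}$ for $i\le k\le l$. Its Płonka sum has as universe the disjoint union $\bigsqcup_{i\in I}A_i$ and operations $f(x_1,\dots,x_n)=f^{A_k}(p_{i_1k}(x_1),\dots,p_{i_nk}(x_n))$ for $x_m\in A_{i_m}$ and $k=i_1\vee\dots\vee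 i_n$; constants are interpreted in $A_{i_0}$. Theorem. Let $V$ be a strongly irregular variety, $A\in R(V)$, and $(a_j)_{j\in J}$ a family of elements of $A$. Then $A$ is free in $R(V)$ on $(a_j)_{j\in J}$ if and only if $A$ is (up to an isomorphism, used below as an identification) the Płonka sum of a semilattice direct system $(\{A_i\}_{i\in I},(I,\le),\{p_{ik}\}_{i\le k})$, for which there are a map $\iota\colon J\to I$ and elements $g^i_j\in A_i$ for all $i\in I$ and all $j\in J$ with $\iota(j)\le i$ (such $j$ are called the components of $i$), such that: 1. $(I,\le)$ is the free join semilattice with zero on the generators $(\iota(j))_{j\in J}$: every map from $J$ to a join semilattice with zero $S$ extends uniquely along $\iota$ to a homomorphism $I\to S$ preserving binary joins and zero. 2. Every $i\in I$ has finitely many components, and $A_i$ is free in $V$ on the family of the $g^i_j$, $j$ ranging over the components of $i$. For $n\in\mathbb N$, $i$ has exactly $n$ components if and only if $i=\iota(j_1)\vee\dots\vee \iota(j_n)$ for some distinct $j_1,\dots,j_n\in J$ (the empty join being $i_0$). Moreover $g^{\iota(j)}_j=a_j$ for every $j\in J$. 3. For every $i\in I$, $p_{i_0i}$ is the unique homomorphism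 $A_{i_0}\to A_i$. For every $j\in J$ and every $i\in I$ with $\iota(j)\le i$, $p_{\iota(j)i}$ is injective and is the unique homomorphism $A_{\iota(j)}\to A_i$ with $a_j\mapsto g^i_j$. For all $i\le k$ in $I$ with $i\ne i_0$, $p_{ik}$ is injective and is the unique homomorphism $A_i\to A_k$ with $g^i_j\mapsto g^k_j$ for every component $j$ of $i$. -/

import Mathlib

universe u v w

open scoped FirstOrder

/-- An identity `lhs ≈ rhs` between terms in countably many variables. -/
structure Identity (L : FirstOrder.Language.{u, v}) where
  lhs : L.Term ℕ
  rhs : L.Term ℕ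

/-- The algebra `A` satisfies the identity `e`. -/
def Identity.HoldsIn {L : FirstOrder.Language.{u, v}} (e : Identity L) (A : Type w) [L.Structure A] : Prop :=
  ∀ x : ℕ → A, e.lhs.realize x = e.rhs.realize x

/-- An identity is regular if the same variables occur on both sides. -/
def Identity.IsRegular {L : FirstOrder.Language.{u, v}} (e : Identity L) : Prop :=
  e.lhs.varFinset = e.rhs.varFinset

/-- A variety (equational class) of `L`-algebras, given by a set of defining identities. -/
structure Variety (L : FirstOrder.Language.{u, v}) where
  eqns : Set (Identity L)

/-- Membership of an algebra in a variety. -/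
def Variety.Mem {L : FirstOrder.Language.{u, v}} (V : Variety L) (A : Type w) [L.Structure A] : Prop :=
  ∀ e ∈ V.eqns, e.HoldsIn A

/-- `V ⊨ e`: the identity `e` holds in every algebra of the variety `V`. -/
def Variety.Valid {L : FirstOrder.Language.{u, v}} (V : Variety L) (e : Identity L) : Prop :=
  ∀ (A : Type u) [L.Structure A], V.Mem A → e.HoldsIn A

/-- `V` is strongly irregular: there is a term `t(x, y)`, in which both variables `x` and `y`
actually occur, such that `V ⊨ t(x, y) ≈ x`. -/
def Variety.StronglyIrregular {L : FirstOrder.Language.{u, v}} (V : Variety L) : Prop :=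
  ∃ t : L.Term ℕ, t.varFinset = {0, 1} ∧ V.Valid ⟨t, FirstOrder.Language.Term.var 0⟩

/-- The regularization `R(V)`: the variety defined by all regular identities valid in `V`. -/
def Variety.regularization {L : FirstOrder.Language.{u, v}} (V : Variety L) : Variety L where
  eqns := {e | V.Valid e ∧ e.IsRegular}

/-- `A` is free in the variety `V` on the family of generators `a`: it lies in `V`, it is generated
by the `a x`, and every map from the generators to an algebra `B` of `V` extends to a homomorphism
(necessarily unique, since `A` is generated by the `a x`). -/
def Variety.IsFreeOn {L : FirstOrder.Language.{u, v}} (V : Variety L) (A : Type u) [L.Structure A]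
    {X : Type u} (a : X → A) : Prop :=
  V.Mem A ∧ FirstOrder.Language.Substructure.closure L (Set.range a) = ⊤ ∧
    ∀ (B : Type u) [L.Structure B], V.Mem B →
      ∀ f : X → B, ∃ h : A →[L] B, ∀ x, h (a x) = f x

/-- `I` is the free join semilattice with zero on the family of generators `ι : J → I`. -/
def IsFreeSemilatticeWithZero {J I : Type u} [SemilatticeSup I] [OrderBot I] (ι : J → I) : Prop :=
  ∀ (S : Type u) [SemilatticeSup S] [OrderBot S] (f : J → S),
    ∃! h : SupBotHom I S, ∀ j, h (ι j) = f j

/-- A semilattice direct system of `L`-algebras over a join semilattice with least element. -/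
structure SemilatticeSystem (L : FirstOrder.Language.{u, v}) (I : Type u) [SemilatticeSup I] [OrderBot I] where
  fibre : I → Type u
  str : ∀ i, L.Structure (fibre i)
  map : ∀ {i j : I}, i ≤ j → (fibre i →[L] fibre j)
  map_refl : ∀ (i : I) (x : fibre i), map (le_refl i) x = x
  map_trans : ∀ {i j k : I} (hij : i ≤ j) (hjk : j ≤ k) (x : fibre i),
    map (hij.trans hjk) x = map hjk (map hij x)

attribute [instance] SemilatticeSystem.str

/-- The universe of the Płonka sum: the disjoint union of the fibres. -/
def SemilatticeSystem.PlonkaSum {L : FirstOrder.Language.{u, v}} {I : Type u} [SemilatticeSup I] [OrderBot I]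
    (S : SemilatticeSystem L I) : Type u :=
  Σ i : I, S.fibre i

/-- The operations of the Płonka sum: all arguments are moved to the fibre over the join of their
indices. For constants this join is empty, so they are interpreted in the fibre over `⊥`. -/
instance SemilatticeSystem.plonkaStructure {L : FirstOrder.Language.{u, v}} [L.IsAlgebraic] {I : Type u}
    [SemilatticeSup I] [OrderBot I] (S : SemilatticeSystem L I) : L.Structure S.PlonkaSum where
  funMap := fun {n} f x =>
    ⟨Finset.univ.sup (fun k : Fin n => (x k).1),
      FirstOrder.Language.Structure.funMap f
        (fun k : Fin n =>
          S.map (Finset.le_sup (f := fun k : Fin n => (x k).1) (Finset.mem_univ k)) (x k).2)⟩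
  RelMap := fun {_} r _ => isEmptyElim r

/-- The (join) components of `i`: the generators lying below `i`. -/
abbrev Components {J I : Type u} [SemilatticeSup I] (ι : J → I) (i : I) : Type u :=
  {j : J // ι j ≤ i}

/-! A generated member of a variety is free as soon as any two terms agreeing on the generators
agree throughout the variety (`isFreeOn_of_termEq`). In a Płonka sum, the value of a term lies over
the join of the indices of its variables, and is computed in that fibre after pushing the arguments
there (`fst_realize`, `map_snd_realize`). If two terms agree on the generators, freeness of the
semilattice forces equal variable sets, and freeness of the fibre makes the equation valid in `V`.
It is then a regular identity of `V`, hence valid in `R(V)`. Strong irregularity serves for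
generation: `t(p, z) ≈ p` pushes `p` into the fibre of any `z` above it, so the generators reach
every fibre. This gives the converse direction (`isFreeOn_plonkaSum`). For the forward direction,
the Płonka sum of the `V`-free algebras over the finite subsets of `J` is free on `J`, hence
isomorphic to `A`. -/

open FirstOrder FirstOrder.Language

/-! ### Terms, their variables and generated algebras. -/

namespace FirstOrder.Language.Term

variable {L : FirstOrder.Language.{u, v}} {α : Type*}

theorem realize_congr_varFinset [DecidableEq α] {M : Type*} [L.Structure M] (t : L.Term α)
    {x y : α → M} (h : ∀ a ∈ t.varFinset, x a = y a) : t.realize x = t.realize y := by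
  induction t with
  | var a => exact h a (Finset.mem_singleton_self a)
  | func f ts ih =>
    simp only [realize_func]
    congr 1
    funext k
    exact ih k fun a ha => h a (Finset.mem_biUnion.2 ⟨k, Finset.mem_univ k, ha⟩)

theorem varFinset_relabel {β : Type*} [DecidableEq α] [DecidableEq β] (t : L.Term α) (φ : α → β) :
    (t.relabel φ).varFinset = t.varFinset.image φ := by
  induction t with
  | var a => simp
  | func f ts ih => simp [ih, Finset.biUnion_image]

end FirstOrder.Language.Term

namespace FirstOrder.Language

variable {L : FirstOrder.Language.{u, v}}

theorem exists_realize_of_closure_eq_top {M X : Type*} [L.Structure M] {a : X → M}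
    (h : Substructure.closure L (Set.range a) = ⊤) (x : M) : ∃ t : L.Term X, t.realize a = x := by
  have hx : x ∈ Substructure.closure L (Set.range a) := h ▸ trivial
  refine Substructure.closure_induction (p := fun x => ∃ t : L.Term X, t.realize a = x) hx ?_ ?_
  · rintro _ ⟨j, rfl⟩
    exact ⟨Term.var j, rfl⟩
  · intro n f y hy
    choose t ht using hy
    exact ⟨Term.func f t, by simp only [Term.realize_func, ht]⟩

theorem closure_range_comp_eq_top {M N X : Type*} [L.Structure M] [L.Structure N] {a : X → M}
    (h : Substructure.closure L (Set.range a) = ⊤) (e : M →[L] N) (he : Function.Surjective e) :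
    Substructure.closure L (Set.range (e ∘ a)) = ⊤ := by
  rw [Set.range_comp, Substructure.closure_image, h]
  exact SetLike.coe_injective (by simpa using he.range_eq)

end FirstOrder.Language

/-! ### Free algebras of a variety and equality of terms. -/

namespace Variety

variable {L : FirstOrder.Language.{u, v}} (V : Variety L)

/-- The terms `s` and `t` take equal values under all assignments in algebras of `V`. -/
def TermEq {X : Type u} (s t : L.Term X) : Prop :=
  ∀ (B : Type u) [L.Structure B], V.Mem B → ∀ f : X → B, s.realize f = t.realize f

variable {V}

/-- Finitely many variables occur, so they can be renamed injectively into `ℕ`, which turns the pair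
into a defining identity of `R(V)`. -/
theorem TermEq.realize_eq_of_mem_regularization {X : Type u} [DecidableEq X] {s t : L.Term X}
    (h : V.TermEq s t) (hvar : s.varFinset = t.varFinset) : V.regularization.TermEq s t := by
  intro B _ hB f
  obtain ⟨φ, hφ⟩ : ∃ φ : X → ℕ, Set.InjOn φ s.varFinset :=
    Set.countable_iff_exists_injOn.1 s.varFinset.countable_toSet
  let e : Identity L := ⟨s.relabel φ, t.relabel φ⟩
  have he : e ∈ V.regularization.eqns := by
    refine ⟨fun D _ hD x => ?_, ?_⟩
    · simpa [e] using h D hD (x ∘ φ)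
    · simp only [e, Identity.IsRegular, Term.varFinset_relabel, hvar]
  -- `s.realize f` is merely an available element of `B`; it serves as the default without assuming
  -- `B` nonempty.
  let x : ℕ → B := fun n =>
    open Classical in if h : ∃ j ∈ s.varFinset, φ j = n then f h.choose else s.realize f
  have hx : ∀ j ∈ s.varFinset, x (φ j) = f j := by
    intro j hj
    have h' : ∃ j' ∈ s.varFinset, φ j' = φ j := ⟨j, hj, rfl⟩
    simp only [x, dif_pos h']
    rw [hφ h'.choose_spec.1 hj h'.choose_spec.2]
  have hxe := hB e he x
  simp only [e, Term.realize_relabel] at hxe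
  have hs : s.realize (x ∘ φ) = s.realize f := Term.realize_congr_varFinset s hx
  have ht : t.realize (x ∘ φ) = t.realize f := Term.realize_congr_varFinset t (hvar ▸ hx)
  rwa [hs, ht] at hxe

/-- Choose a term for each element and evaluate it in `B`; the hypothesis makes the result
independent of the choice, hence a homomorphism. -/
theorem isFreeOn_of_termEq [L.IsAlgebraic] {A X : Type u} [L.Structure A] {a : X → A}
    (hA : V.Mem A) (htop : Substructure.closure L (Set.range a) = ⊤)
    (h : ∀ s t : L.Term X, s.realize a = t.realize a → V.TermEq s t) : V.IsFreeOn A a := by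
  refine ⟨hA, htop, fun B _ hB f => ?_⟩
  choose τ hτ using exists_realize_of_closure_eq_top htop
  refine ⟨⟨fun x => (τ x).realize f, fun {n} F x => ?_, fun r => isEmptyElim r⟩, fun j => ?_⟩
  · refine h _ (Term.func F fun k => τ (x k)) ?_ B hB f
    simp only [Term.realize_func, hτ]
  · exact h _ (Term.var j) (hτ _) B hB f

theorem IsFreeOn.termEq {A X : Type u} [L.Structure A] {a : X → A} (h : V.IsFreeOn A a)
    {s t : L.Term X} (hst : s.realize a = t.realize a) : V.TermEq s t := by
  intro B _ hB f
  obtain ⟨q, hq⟩ := h.2.2 B hB f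
  have : f = q ∘ a := funext fun x => (hq x).symm
  rw [this, HomClass.realize_term, HomClass.realize_term, hst]

theorem IsFreeOn.hom_ext {A X : Type u} [L.Structure A] {a : X → A} (h : V.IsFreeOn A a)
    {B : Type*} [L.Structure B] {p q : A →[L] B} (hpq : ∀ x, p (a x) = q (a x)) : p = q :=
  Hom.eq_of_eqOn_dense h.2.1 (by rintro _ ⟨x, rfl⟩; exact hpq x)

theorem IsFreeOn.exists_equiv [L.IsAlgebraic] {A B X : Type u} [L.Structure A] [L.Structure B]
    {a : X → A} {b : X → B} (hA : V.IsFreeOn A a) (hB : V.IsFreeOn B b) :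
    ∃ e : A ≃[L] B, ∀ x, e (a x) = b x := by
  obtain ⟨p, hp⟩ := hA.2.2 B hB.1 b
  obtain ⟨q, hq⟩ := hB.2.2 A hA.1 a
  have hqp : q.comp p = Hom.id L A := hA.hom_ext fun x => by simp [hp, hq]
  have hpq : p.comp q = Hom.id L B := hB.hom_ext fun x => by simp [hp, hq]
  exact ⟨⟨⟨p, q, fun x => DFunLike.congr_fun hqp x, fun x => DFunLike.congr_fun hpq x⟩,
    fun f x => p.map_fun f x, fun r => isEmptyElim r⟩, hp⟩

theorem IsFreeOn.of_equiv {A B X : Type u} [L.Structure A] [L.Structure B]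
    {a : X → A} {b : X → B} (hA : V.IsFreeOn A a) (hB : V.Mem B) (e : A ≃[L] B)
    (he : ∀ x, e (a x) = b x) : V.IsFreeOn B b := by
  obtain rfl : e.toHom ∘ a = b := funext he
  refine ⟨hB, closure_range_comp_eq_top hA.2.1 e.toHom e.surjective, fun C _ hC f => ?_⟩
  obtain ⟨q, hq⟩ := hA.2.2 C hC f
  exact ⟨q.comp e.symm.toHom, fun x => by simp [hq]⟩

variable (V)

/-- The congruence on the term algebra consisting of the identities of `V`. -/
def termSetoid (X : Type u) : Setoid (L.Term X) where
  r := V.TermEq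
  iseqv := ⟨fun _ _ _ _ _ => rfl, fun h B _ hB f => (h B hB f).symm,
    fun h h' B _ hB f => (h B hB f).trans (h' B hB f)⟩

instance termPrestructure [L.IsAlgebraic] (X : Type u) : L.Prestructure (V.termSetoid X) where
  toStructure := { funMap := fun f ts => Term.func f ts, RelMap := fun r _ => isEmptyElim r }
  fun_equiv x y h B _ hB f := by
    simp only [Structure.funMap, Term.realize_func]
    exact congrArg _ (funext fun k => h k B hB f)
  rel_equiv {_} r := isEmptyElim r

/-- The free algebra of `V` over `X`, a quotient of the term algebra. -/
abbrev FreeAlgebra (X : Type u) : Type u := Quotient (V.termSetoid X)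

theorem isFreeOn_freeAlgebra [L.IsAlgebraic] (X : Type u) :
    V.IsFreeOn (V.FreeAlgebra X) (fun x => Quotient.mk _ (Term.var x)) := by
  let _ := (V.termPrestructure X).toStructure
  have eval : ∀ t : L.Term X,
      (t.realize fun x => (Quotient.mk _ (Term.var x) : V.FreeAlgebra X)) = Quotient.mk _ t := by
    intro t
    rw [Term.realize_quotient_mk']
    congr 1
    induction t with
    | var => rfl
    | func f ts ih => simp only [Term.realize_func, ih]; rfl
  refine isFreeOn_of_termEq ?_ ?_ ?_
  · intro e he x
    obtain ⟨r, rfl⟩ : ∃ r : ℕ → L.Term X, (fun n => Quotient.mk _ (r n)) = x :=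
      ⟨fun n => (x n).out, funext fun n => Quotient.out_eq _⟩
    rw [Term.realize_quotient_mk', Term.realize_quotient_mk']
    refine Quotient.sound fun B _ hB f => ?_
    -- Evaluation is a homomorphism from the term algebra, so substituting `r` and then evaluating
    -- is an assignment in `B`, where `e` holds.
    let ev : L.Term X →[L] B := ⟨Term.realize f, fun _ _ => rfl, fun r => isEmptyElim r⟩
    change ev _ = ev _
    rw [← HomClass.realize_term, ← HomClass.realize_term]
    exact hB e he _
  · refine eq_top_iff.2 fun x _ => ?_
    induction x using Quotient.inductionOn with
    | _ t =>
      rw [← eval]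
      exact t.realize_mem _ fun x => Substructure.subset_closure ⟨x, rfl⟩
  · intro s t h
    rw [eval, eval] at h
    exact Quotient.exact h

end Variety

/-! ### Płonka sums. -/

namespace SemilatticeSystem

variable {L : FirstOrder.Language.{u, v}} {I : Type u} [SemilatticeSup I]
  [OrderBot I] (S : SemilatticeSystem L I)

/-- The inclusion of a fibre into the Płonka sum. -/
def incl (i : I) (x : S.fibre i) : S.PlonkaSum := ⟨i, x⟩

/-- Variables whose values do not lie below `i` get the default `z`; a fibre may be empty, so `z`
has to be supplied. -/
theorem exists_assignment {α : Type*} {i : I} (z : S.fibre i) (x : α → S.PlonkaSum) :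
    ∃ y : α → S.fibre i, ∀ j (hj : (x j).1 ≤ i), y j = S.map hj (x j).2 := by
  classical
  exact ⟨fun j => if hj : (x j).1 ≤ i then S.map hj (x j).2 else z, fun j hj => dif_pos hj⟩

/-- Comparing after the maps into a common fibre replaces transport along equalities of indices. -/
theorem eq_of_map_eq {i : I} {p q : S.PlonkaSum} (hp : p.1 = i) (hq : q.1 = i)
    (h : S.map hp.le p.2 = S.map hq.le q.2) : p = q := by
  obtain ⟨p, x⟩ := p
  obtain ⟨q, y⟩ := q
  dsimp only at hp hq h
  subst hp
  subst hq
  rw [S.map_refl, S.map_refl] at h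
  rw [h]

variable [L.IsAlgebraic]

theorem fst_realize {α : Type*} [DecidableEq α] (t : L.Term α) (x : α → S.PlonkaSum) :
    (t.realize x).1 = t.varFinset.sup fun j => (x j).1 := by
  induction t with
  | var a => simp
  | func f ts ih =>
    simp only [Term.realize_func, Term.varFinset, Finset.sup_biUnion, ← ih]
    rfl

theorem map_snd_realize {α : Type*} {i : I} (t : L.Term α) (x : α → S.PlonkaSum)
    (y : α → S.fibre i) (hy : ∀ j (hj : (x j).1 ≤ i), y j = S.map hj (x j).2)
    (h : (t.realize x).1 ≤ i) : S.map h (t.realize x).2 = t.realize y := by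
  induction t with
  | var a => exact (hy a h).symm
  | func f ts ih =>
    have hle : ∀ k, ((ts k).realize x).1 ≤ (Structure.funMap f fun k => (ts k).realize x).1 :=
      fun k => Finset.le_sup (f := fun k => ((ts k).realize x).1) (Finset.mem_univ k)
    refine (Hom.map_fun _ f _).trans ?_
    simp only [Term.realize_func]
    congr 1
    funext k
    rw [← ih k ((hle k).trans h)]
    exact (S.map_trans (hle k) h _).symm

/-- Regularity puts both sides over the same index; the identity then holds in that single fibre. -/
theorem mem_regularization {V : Variety L} (hS : ∀ i, V.Mem (S.fibre i)) :
    V.regularization.Mem S.PlonkaSum := by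
  rintro e ⟨hval, hreg⟩ x
  obtain ⟨y, hy⟩ := S.exists_assignment (e.lhs.realize x).2 x
  have hfst : (e.rhs.realize x).1 = (e.lhs.realize x).1 := by
    rw [S.fst_realize, S.fst_realize, hreg]
  refine S.eq_of_map_eq rfl hfst ?_
  rw [S.map_snd_realize _ x y hy, S.map_snd_realize _ x y hy]
  exact hval _ (hS _) y

variable {S}

/-- The image of `p` is `t(p, z)`: since `z` occurs, the value lies over `i`, and there `t(x, y) ≈
x` applies. -/
theorem map_mem_of_mem {V : Variety L} (hV : V.StronglyIrregular) (hS : ∀ i, V.Mem (S.fibre i))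
    (C : L.Substructure S.PlonkaSum) {p : S.PlonkaSum} (hp : p ∈ C) {i : I} (h : p.1 ≤ i)
    {z : S.fibre i} (hz : S.incl i z ∈ C) : S.incl i (S.map h p.2) ∈ C := by
  obtain ⟨t, hvar, hval⟩ := hV
  let x : ℕ → S.PlonkaSum := fun n => if n = 0 then p else S.incl i z
  have hx : ∀ n, x n ∈ C := fun n => by
    dsimp only [x]
    split_ifs
    exacts [hp, hz]
  have hfst : (t.realize x).1 = i := by
    rw [S.fst_realize, hvar]
    simp [x, h, incl]
  obtain ⟨y, hy⟩ := S.exists_assignment z x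
  have heq : t.realize x = S.incl i (S.map h p.2) := by
    refine S.eq_of_map_eq hfst rfl ?_
    rw [S.map_snd_realize _ x y hy]
    exact ((hval _ (hS i) y).trans (hy 0 h)).trans (S.map_refl i _).symm
  exact heq ▸ t.realize_mem x hx

theorem closure_range_eq_top {V : Variety L} (hV : V.StronglyIrregular) {J : Type u} {ι : J → I}
    {g : (i : I) → Components ι i → S.fibre i} (hS : ∀ i, V.IsFreeOn (S.fibre i) (g i))
    (hsup : ∀ i, ∃ F : Finset J, i = F.sup ι)
    (hmap : ∀ j i (h : ι j ≤ i), S.map h (g (ι j) ⟨j, le_rfl⟩) = g i ⟨j, h⟩) :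
    Substructure.closure L
      (Set.range fun j => S.incl (ι j) (g (ι j) ⟨j, le_rfl⟩)) = ⊤ := by
  classical
  set C := Substructure.closure L
    (Set.range fun j => S.incl (ι j) (g (ι j) ⟨j, le_rfl⟩))
  have hgen : ∀ j, S.incl (ι j) (g (ι j) ⟨j, le_rfl⟩) ∈ C := fun j =>
    Substructure.subset_closure ⟨j, rfl⟩
  have hfib : ∀ i, i = ⊥ ∨ ∃ z : S.fibre i, S.incl i z ∈ C := by
    intro i
    obtain ⟨F, rfl⟩ := hsup i
    induction F using Finset.induction_on with
    | empty => exact Or.inl Finset.sup_empty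
    | insert j F _ ih =>
      right
      -- Only the occurrence of both variables matters here: `t` serves as a binary operation whose
      -- value lies over the join.
      obtain ⟨t, hvar, -⟩ := hV
      suffices ∃ q ∈ C, q.1 = (insert j F).sup ι by
        obtain ⟨⟨k, z⟩, hq, rfl⟩ := this
        exact ⟨z, hq⟩
      rw [Finset.sup_insert]
      rcases ih with ih | ⟨z, hz⟩
      · exact ⟨_, hgen j, by simp [ih, incl]⟩
      · let x : ℕ → S.PlonkaSum := fun n =>
          if n = 0 then S.incl (ι j) (g (ι j) ⟨j, le_rfl⟩) else S.incl (F.sup ι) z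
        refine ⟨t.realize x, t.realize_mem x fun n => ?_, ?_⟩
        · dsimp only [x]
          split_ifs
          exacts [hgen j, hz]
        · rw [S.fst_realize, hvar]
          simp [x, incl]
  have hMem : ∀ i, V.Mem (S.fibre i) := fun i => (hS i).1
  have hpush : ∀ p ∈ C, ∀ i (h : p.1 ≤ i), S.incl i (S.map h p.2) ∈ C := by
    intro p hp i h
    -- The fibre over `⊥` may contain no element of `C`, but an element mapped into it already lies
    -- there.
    rcases hfib i with rfl | ⟨z, hz⟩
    · have hb : p.1 = ⊥ := le_bot_iff.1 h
      have : p = S.incl ⊥ (S.map h p.2) := S.eq_of_map_eq hb rfl (S.map_refl _ _).symm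
      exact this ▸ hp
    · exact map_mem_of_mem hV hMem C hp h hz
  refine eq_top_iff.2 ?_
  rintro ⟨i, x⟩ -
  have hx : x ∈ Substructure.closure L (Set.range (g i)) := (hS i).2.1 ▸ trivial
  refine Substructure.closure_induction
    (p := fun x => S.incl i x ∈ C) hx ?_ ?_
  · rintro _ ⟨⟨j, hj⟩, rfl⟩
    rw [← hmap]
    exact hpush _ (hgen j) i hj
  · intro n f y hy
    -- For a constant this value lies over `⊥` instead of `i`, so it still has to be pushed up to
    -- `i`.
    have hmem := C.fun_mem f (fun k => S.incl i (y k)) hy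
    have hle : (Structure.funMap f fun k => S.incl i (y k)).1 ≤ i :=
      Finset.sup_le (s := Finset.univ) (f := fun _ : Fin n => i) fun _ _ => le_rfl
    have heq : S.map hle (Structure.funMap f fun k => S.incl i (y k)).2
        = Structure.funMap f y := by
      refine (Hom.map_fun _ f _).trans (congrArg _ (funext fun k => ?_))
      exact (S.map_trans _ hle _).symm.trans (S.map_refl _ _)
    have := hpush _ hmem i hle
    rwa [heq] at this

theorem isFreeOn_plonkaSum {V : Variety L} (hV : V.StronglyIrregular) {J : Type u} {ι : J → I}
    {g : (i : I) → Components ι i → S.fibre i} (hS : ∀ i, V.IsFreeOn (S.fibre i) (g i))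
    (hι : ∀ (F : Finset J) (j : J), ι j ≤ F.sup ι → j ∈ F)
    (hsup : ∀ i, ∃ F : Finset J, i = F.sup ι)
    (hmap : ∀ j i (h : ι j ≤ i), S.map h (g (ι j) ⟨j, le_rfl⟩) = g i ⟨j, h⟩) :
    V.regularization.IsFreeOn S.PlonkaSum fun j => S.incl (ι j) (g (ι j) ⟨j, le_rfl⟩) := by
  classical
  refine Variety.isFreeOn_of_termEq (S.mem_regularization fun i => (hS i).1)
    (closure_range_eq_top hV hS hsup hmap) fun s t hst => ?_
  set a : J → S.PlonkaSum := fun j => S.incl (ι j) (g (ι j) ⟨j, le_rfl⟩)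
  have hsfst : (s.realize a).1 = s.varFinset.sup ι := S.fst_realize s a
  have htfst : (t.realize a).1 = t.varFinset.sup ι := S.fst_realize t a
  have hsupeq : s.varFinset.sup ι = t.varFinset.sup ι := by rw [← hsfst, ← htfst, hst]
  have hvar : s.varFinset = t.varFinset := Finset.Subset.antisymm
    (fun j hj => hι _ j (hsupeq ▸ Finset.le_sup hj))
    (fun j hj => hι _ j (hsupeq ▸ Finset.le_sup hj))
  refine Variety.TermEq.realize_eq_of_mem_regularization (fun B _ hB f => ?_) hvar
  set i := (s.realize a).1
  obtain ⟨y, hy⟩ := S.exists_assignment (s.realize a).2 a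
  have hle : (t.realize a).1 ≤ i := (congrArg Sigma.fst hst).ge
  have hsy : s.realize y = t.realize y := by
    rw [← S.map_snd_realize s a y hy le_rfl, ← S.map_snd_realize t a y hy hle]
    -- Both values are generalized to variables so that their equality can be eliminated despite the
    -- dependent fibres.
    have aux : ∀ (p q : S.PlonkaSum) (_ : p = q) (h : p.1 ≤ i) (h' : q.1 ≤ i),
        S.map h p.2 = S.map h' q.2 := by
      rintro p _ rfl _ _
      rfl
    exact aux _ _ hst _ _
  obtain ⟨q, hq⟩ := (hS i).2.2 B hB fun j => f j.1
  have hqy : ∀ j ∈ s.varFinset, (q ∘ y) j = f j := by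
    intro j hj
    have hji : ι j ≤ i := hsfst ▸ Finset.le_sup hj
    rw [Function.comp_apply, (hy j hji).trans (hmap j i hji)]
    exact hq ⟨j, hji⟩
  rw [← Term.realize_congr_varFinset s hqy, ← Term.realize_congr_varFinset t (hvar ▸ hqy),
    HomClass.realize_term, HomClass.realize_term, hsy]

end SemilatticeSystem

/-! ### Free semilattices with zero. -/

theorem isFreeSemilatticeWithZero_singleton (J : Type u) [DecidableEq J] :
    IsFreeSemilatticeWithZero (fun j : J => ({j} : Finset J)) := by
  intro S _ _ f
  refine ⟨⟨⟨fun F => F.sup f, fun F G => Finset.sup_union⟩, Finset.sup_empty (f := f)⟩,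
    fun j => Finset.sup_singleton (f := f) (b := j), fun h hh => ?_⟩
  ext F
  change h F = F.sup f
  conv_lhs => rw [← Finset.sup_singleton_eq_self F]
  rw [map_finset_sup]
  exact Finset.sup_congr rfl fun j _ => hh j

/-- The homomorphism to `Finset J` extending `j ↦ {j}` turns the inequality into `{j} ⊆ F`. -/
theorem IsFreeSemilatticeWithZero.mem_of_le_sup {J I : Type u} [SemilatticeSup I] [OrderBot I]
    {ι : J → I} (hι : IsFreeSemilatticeWithZero ι) (F : Finset J) (j : J) (h : ι j ≤ F.sup ι) :
    j ∈ F := by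
  classical
  obtain ⟨q, hq, -⟩ := hι (Finset J) fun j => {j}
  have hqF := OrderHomClass.mono q h
  rw [hq, map_finset_sup, show q ∘ ι = singleton from funext hq,
    Finset.sup_singleton_eq_self] at hqF
  exact Finset.singleton_subset_iff.1 hqF

/-! ### The direct system of free algebras over sets of components. -/

namespace Variety

variable {L : FirstOrder.Language.{u, v}} [L.IsAlgebraic] (V : Variety L) {J I : Type u}
  [SemilatticeSup I] (ι : J → I)

/-- The generator of the free algebra over the components of `i` that belongs to a component. -/
def componentGen (i : I) (j : Components ι i) : V.FreeAlgebra (Components ι i) :=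
  Quotient.mk _ (Term.var j)

theorem isFreeOn_componentGen (i : I) :
    V.IsFreeOn (V.FreeAlgebra (Components ι i)) (V.componentGen ι i) :=
  V.isFreeOn_freeAlgebra _

theorem exists_componentHom {i k : I} (h : i ≤ k) :
    ∃ q : V.FreeAlgebra (Components ι i) →[L] V.FreeAlgebra (Components ι k),
      ∀ j : Components ι i, q (V.componentGen ι i j) = V.componentGen ι k ⟨j.1, j.2.trans h⟩ :=
  (V.isFreeOn_componentGen ι i).2.2 _ (V.isFreeOn_componentGen ι k).1 _

/-- The homomorphism of free algebras induced by the inclusion of the components of `i` into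
those of `k`. -/
noncomputable def componentHom {i k : I} (h : i ≤ k) :
    V.FreeAlgebra (Components ι i) →[L] V.FreeAlgebra (Components ι k) :=
  (V.exists_componentHom ι h).choose

theorem componentHom_gen {i k : I} (h : i ≤ k) (j : Components ι i) :
    V.componentHom ι h (V.componentGen ι i j) = V.componentGen ι k ⟨j.1, j.2.trans h⟩ :=
  (V.exists_componentHom ι h).choose_spec j

/-- There is a retraction, collapsing the generators that are not components of `i` to that of `j₀`;
this is why `i` needs a component. -/
theorem componentHom_injective {i k : I} (h : i ≤ k) (j₀ : Components ι i) :
    Function.Injective (V.componentHom ι h) := by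
  classical
  obtain ⟨r, hr⟩ := (V.isFreeOn_componentGen ι k).2.2 _ (V.isFreeOn_componentGen ι i).1
    fun j => if hj : ι j.1 ≤ i then V.componentGen ι i ⟨j.1, hj⟩ else V.componentGen ι i j₀
  have : r.comp (V.componentHom ι h) = Hom.id L _ :=
    (V.isFreeOn_componentGen ι i).hom_ext fun j => by
      simp only [Hom.comp_apply, componentHom_gen, hr, dif_pos j.2, Hom.id_apply]
  exact Function.LeftInverse.injective (g := r) fun x => DFunLike.congr_fun this x

/-- The system of the free algebras of `V` over the sets of components of the elements of `I`. -/
noncomputable def componentSystem [OrderBot I] : SemilatticeSystem L I where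
  fibre i := V.FreeAlgebra (Components ι i)
  str _ := inferInstance
  map h := V.componentHom ι h
  map_refl i x := by
    have : V.componentHom ι (le_refl i) = Hom.id L _ :=
      (V.isFreeOn_componentGen ι i).hom_ext fun j => V.componentHom_gen ι _ j
    rw [this, Hom.id_apply]
  map_trans {i j k} hij hjk x := by
    have : V.componentHom ι (hij.trans hjk) = (V.componentHom ι hjk).comp (V.componentHom ι hij) :=
      (V.isFreeOn_componentGen ι i).hom_ext fun j => by
        simp only [Hom.comp_apply, componentHom_gen]
    rw [this, Hom.comp_apply]

end Variety

theorem mainTheorem7 {L : FirstOrder.Language.{u, v}} [L.IsAlgebraic] (V : Variety L)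
    (hV : V.StronglyIrregular) (A : Type u) [L.Structure A] (hA : V.regularization.Mem A)
    {J : Type u} (a : J → A) :
    V.regularization.IsFreeOn A a ↔
      ∃ (I : Type u) (_ : SemilatticeSup I) (_ : OrderBot I) (S : SemilatticeSystem L I)
        (e : S.PlonkaSum ≃[L] A) (ι : J → I) (g : (i : I) → Components ι i → S.fibre i),
        -- (1) the index semilattice is the free semilattice with zero on `J`
        IsFreeSemilatticeWithZero ι ∧
        -- (2) the fibre over `i` is `V`-free on finitely many generators `g i j`, one for each
        -- component `j` of `i`; there are `n` of them iff `i` is a join of `n` distinct generators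
        (∀ i : I, Finite (Components ι i) ∧ V.IsFreeOn (S.fibre i) (g i) ∧
          ∀ n : ℕ, Nat.card (Components ι i) = n ↔
            ∃ s : Finset J, s.card = n ∧ i = s.sup ι) ∧
        -- and the generator of the fibre over `ι j` is `a j`
        (∀ j : J, e ⟨ι j, g (ι j) ⟨j, le_rfl⟩⟩ = a j) ∧
        -- (3) the map from the least fibre to the fibre over `i` is the unique homomorphism
        (∀ (i : I) (q : S.fibre ⊥ →[L] S.fibre i), q = S.map bot_le) ∧
        -- the map out of the fibre over `ι j` is injective and the unique homomorphism that
        -- sends its generator to the `j`-th generator of the target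
        (∀ (j : J) (i : I) (h : ι j ≤ i), Function.Injective (S.map h) ∧
          S.map h (g (ι j) ⟨j, le_rfl⟩) = g i ⟨j, h⟩ ∧
          ∀ q : S.fibre (ι j) →[L] S.fibre i, q (g (ι j) ⟨j, le_rfl⟩) = g i ⟨j, h⟩ →
            q = S.map h) ∧
        -- for `⊥ ≠ i ≤ k`, the map from `i` to `k` is injective and the unique homomorphism that
        -- matches generators
        (∀ (i k : I) (h : i ≤ k), i ≠ ⊥ → Function.Injective (S.map h) ∧
          (∀ j : Components ι i, S.map h (g i j) = g k ⟨j.1, j.2.trans h⟩) ∧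
          ∀ q : S.fibre i →[L] S.fibre k,
            (∀ j : Components ι i, q (g i j) = g k ⟨j.1, j.2.trans h⟩) → q = S.map h) := by
  constructor
  · intro hfree
    classical
    let ι : J → Finset J := singleton
    let S := V.componentSystem ι
    let g : (i : Finset J) → Components ι i → S.fibre i := V.componentGen ι
    have hS : ∀ i, V.IsFreeOn (S.fibre i) (g i) := V.isFreeOn_componentGen ι
    have hι : IsFreeSemilatticeWithZero ι := isFreeSemilatticeWithZero_singleton J
    have hmap : ∀ {i k : Finset J} (h : i ≤ k) (j : Components ι i),
        S.map h (g i j) = g k ⟨j.1, j.2.trans h⟩ := V.componentHom_gen ι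
    have hsup : ∀ i : Finset J, i.sup ι = i := Finset.sup_singleton_eq_self
    have hplonka := SemilatticeSystem.isFreeOn_plonkaSum hV hS hι.mem_of_le_sup
      (fun i => ⟨i, (hsup i).symm⟩) (fun j i h => hmap h ⟨j, le_rfl⟩)
    obtain ⟨e, he⟩ := hplonka.exists_equiv hfree
    have hcomp : ∀ i : Finset J, ∀ j, ι j ≤ i ↔ j ∈ i := fun i j => Finset.singleton_subset_iff
    have hcard : ∀ i : Finset J, Nat.card (Components ι i) = i.card := fun i => by
      rw [Nat.card_congr (Equiv.subtypeEquivRight (hcomp i))]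
      exact Nat.card_eq_finsetCard i
    refine ⟨Finset J, inferInstance, inferInstance, S, e, ι, g, hι, fun i => ⟨?_, hS i, ?_⟩, he,
      ?_, ?_, ?_⟩
    · exact Finite.of_equiv i (Equiv.subtypeEquivRight (hcomp i)).symm
    · intro n
      rw [hcard]
      constructor
      · rintro rfl
        exact ⟨i, rfl, (hsup i).symm⟩
      · rintro ⟨s, rfl, rfl⟩
        rw [hsup]
    · intro i q
      refine (hS ⊥).hom_ext fun j => ?_
      -- The least fibre is free on the empty family, so there is nothing to compare.
      exact absurd ((hcomp ⊥ j.1).1 j.2) (Finset.notMem_empty _)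
    · intro j i h
      refine ⟨V.componentHom_injective ι h ⟨j, le_rfl⟩, hmap h ⟨j, le_rfl⟩, fun q hq => ?_⟩
      refine (hS (ι j)).hom_ext ?_
      rintro ⟨j', hj'⟩
      obtain rfl : j' = j := Finset.mem_singleton.1 ((hcomp _ _).1 hj')
      exact hq.trans (hmap h ⟨j', le_rfl⟩).symm
    · intro i k h hi
      obtain ⟨j, hj⟩ := Finset.nonempty_iff_ne_empty.2 hi
      exact ⟨V.componentHom_injective ι h ⟨j, (hcomp i j).2 hj⟩, hmap h,
        fun q hq => (hS i).hom_ext fun j => (hq j).trans (hmap h j).symm⟩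
  · rintro ⟨I, _, _, S, e, ι, g, hι, hS, he, -, hgen, -⟩
    refine (SemilatticeSystem.isFreeOn_plonkaSum hV (fun i => (hS i).2.1) hι.mem_of_le_sup
      (fun i => ?_) fun j i h => (hgen j i h).2.1).of_equiv hA e he
    -- Taking `n` to be the actual number of components exhibits `i` as a finite join of generators.
    obtain ⟨s, -, hs⟩ := ((hS i).2.2 _).1 rfl
    exact ⟨s, hs⟩
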